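/- Let $\mathbb{O}$ be the set of ordinals smaller than $\varepsilon_0$. Consider the many-sorted signature with sorts $\mathsf{N},\mathsf{O},\mathsf{S}$ and function symbols $$\mathsf{h}:\mathsf{O},\quad \mathsf{i},\mathsf{E}:\mathsf{O}\to\mathsf{O},\quad {\mid}:\mathsf{O}\times\mathsf{O}\to\mathsf{O},\quad \mathsf{0}:\mathsf{N},\quad \mathsf{s}:\mathsf{N}\to\mathsf{N},\quad \mathsf{C},\mathsf{D}:\mathsf{N}\times\mathsf{O}\to\mathsf{O},\quad \mathsf{A},\mathsf{B}:\mathsf{N}\times\mathsf{O}\to\mathsf{S},$$ with infinitely many variables of each sort, where the infix symbol $\mid$ is the only AC (associative-commutative) symbol. Let $\mathcal{H}$ be the TRS with the rules $$\begin{aligned} \mathsf{A}(n,\mathsf{i}(\mathsf{h})) &\to \mathsf{A}(\mathsf{s}(n),\mathsf{h}) & \mathsf{D}(n,\mathsf{i}(\mathsf{i}(x))) &\to \mathsf{i}(\mathsf{D}(n,\mathsf{i}(x)))\\ \mathsf{A}(n,\mathsf{i}(\mathsf{h}\mid x)) &\to \mathsf{A}(\mathsf{s}(n),\mathsf{i}(x))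 & \mathsf{D}(n,\mathsf{i}(\mathsf{i}(x)\mid y)) &\to \mathsf{i}(\mathsf{D}(n,\mathsf{i}(x))\mid y)\\ \mathsf{A}(n,\mathsf{i}(x)) &\to \mathsf{B}(n,\mathsf{D}(\mathsf{s}(n),\mathsf{i}(x))) & \mathsf{D}(n,\mathsf{i}(\mathsf{i}(\mathsf{h}\mid x)\mid y)) &\to \mathsf{i}(\mathsf{C}(n,\mathsf{i}(x))\mid y)\\ \mathsf{C}(\mathsf{0},x) &\to \mathsf{E}(x) & \mathsf{D}(n,\mathsf{i}(\mathsf{i}(\mathsf{h}\mid x))) &\to \mathsf{i}(\mathsf{C}(n,\mathsf{i}(x)))\\ \mathsf{C}(\mathsf{s}(n),x) &\to x\mid\mathsf{C}(n,x) & \mathsf{D}(n,\mathsf{i}(\mathsf{i}(\mathsf{h})\mid y)) &\to \mathsf{i}(\mathsf{C}(n,\mathsf{h})\mid y)\\ \mathsf{i}(\mathsf{E}(x)\mid y) &\to \mathsf{E}(\mathsf{i}(x\mid y)) & \mathsf{D}(n,\mathsf{i}(\mathsf{i}(\mathsf{h}))) &\to \mathsf{i}(\mathsf{C}(n,\mathsf{h}))\\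 \mathsf{i}(\mathsf{E}(x)) &\to \mathsf{E}(\mathsf{i}(x)) & \mathsf{B}(n,\mathsf{E}(x)) &\to \mathsf{A}(\mathsf{s}(n),x). \end{aligned}$$ Let $\mathcal{A}$ be the algebra with carrier $\mathbb{N}$ for sort $\mathsf{N}$ and carrier $\mathbb{O}$ for sorts $\mathsf{O}$ and $\mathsf{S}$, and with the interpretations $\mathsf{0}_\mathcal{A}=\mathsf{h}_\mathcal{A}=1$, $\mathsf{s}_\mathcal{A}(n)=n+1$, $\mathsf{i}_\mathcal{A}(x)=\omega^x$, $x\mid_\mathcal{A}y=x\oplus y$ (natural addition of ordinals), $\mathsf{E}_\mathcal{A}(x)=x+1$, $\mathsf{C}_\mathcal{A}(n,x)=x\cdot n+1$ and $\mathsf{A}_\mathcal{A}(n,x)=\mathsf{B}_\mathcal{A}(n,x)=\mathsf{D}_\mathcal{A}(n,x)=x$. In the labeled signature, $\mathsf{A}$ and $\mathsf{B}$ are replaced by symbols $\mathsf{A}_v$ and $\mathsf{B}_v$ for all $v\in\mathbb{O}$, with the same sort declarations. For an assignment $\alpha$ of elements of the carriers to the variables, $\mathsf{lab}_\alpha(t)$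 is the result of labeling each occurrence of $\mathsf{A}$ and $\mathsf{B}$ in the term $t$ by the value under $\alpha$ in $\mathcal{A}$ of its second argument. Let $$\mathcal{H}_{\mathsf{lab}}=\{\mathsf{lab}_\alpha(\ell)\to\mathsf{lab}_\alpha(r)\mid \ell\to r\in\mathcal{H},\ \alpha \text{ an assignment}\}$$ and let $\mathcal{D}\mathsf{ec}$ consist of the rules $\mathsf{A}_v(n,x)\to\mathsf{A}_w(n,x)$ and $\mathsf{B}_v(n,x)\to\mathsf{B}_w(n,x)$ for all $v,w\in\mathbb{O}$ with $v>w$. **Theorem.** The infinite TRS $\mathcal{R}=\mathcal{H}_{\mathsf{lab}}\cup\mathcal{D}\mathsf{ec}$ is AC terminating. That is, the relation ${=_{\mathsf{AC}}}\cdot{\to_{\mathcal{R}}}\cdot{=_{\mathsf{AC}}}$ on (well-sorted) terms over the labeled signature is well-founded (there is no infinite sequence of steps), where $\to_{\mathcal{R}}$ is the rewrite relation of $\mathcal{R}$ and $=_{\mathsf{AC}}$ is the equivalence generated by rewriting with $(x\mid y)\mid z\approx x\mid(y\mid z)$ and $x\mid y\approx y\mid x$. -/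

import Mathlib

open scoped Ordinal

universe u v w

namespace HydraAC

/-- An `S`-sorted signature. `Sym [S₁, …, Sₙ] s` is the type of function symbols with sort
declaration `S₁ × ⋯ × Sₙ → s`. `AC s` is the set of those symbols with declaration `s × s → s`
which are AC symbols. -/
structure Signature (S : Type u) where
  Sym : List S → S → Type v
  AC : ∀ s : S, Set (Sym [s, s] s)

/-- Many-sorted terms: `Term Sg s` is the set of terms of sort `s`. Each sort has its own
countably infinite set of variables, named by natural numbers. -/
inductive Term {S : Type u} (Sg : Signature.{u, v} S) : S → Type (max u v)
  | var {s : S} (x : ℕ) : Term Sg s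
  | app {dom : List S} {s : S} (f : Sg.Sym dom s)
      (ts : ∀ i : Fin dom.length, Term Sg (dom.get i)) : Term Sg s

namespace Term

variable {S : Type u} {Sg : Signature.{u, v} S}

/-- The term consisting of a constant. -/
def app0 {s : S} (f : Sg.Sym [] s) : Term Sg s :=
  .app f (fun i => i.elim0)

/-- `f(t)` for a unary symbol. -/
def app1 {a s : S} (f : Sg.Sym [a] s) (t : Term Sg a) : Term Sg s :=
  .app f (fun | ⟨0, _⟩ => t)

/-- `f(t, u)` for a binary symbol. -/
def app2 {a b s : S} (f : Sg.Sym [a, b] s) (t : Term Sg a) (u : Term Sg b) : Term Sg s :=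
  .app f (fun | ⟨0, _⟩ => t | ⟨1, _⟩ => u)

/-- The set of variables (with their sorts) that occur in a term. -/
def vars : {s : S} → Term Sg s → Set (S × ℕ)
  | s, .var x => {(s, x)}
  | _, .app _ ts => ⋃ i, (ts i).vars

@[simp] theorem vars_var {s : S} (x : ℕ) : (var x : Term Sg s).vars = {(s, x)} := by
  simp [vars]

@[simp] theorem vars_app0 {s : S} (f : Sg.Sym [] s) : (app0 f).vars = ∅ := by
  simp [vars, app0]

@[simp] theorem vars_app1 {a s : S} (f : Sg.Sym [a] s) (t : Term Sg a) :
    (app1 f t).vars = t.vars := by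
  ext p
  simp only [app1, vars, Set.mem_iUnion]
  constructor
  · rintro ⟨⟨i, hi⟩, h⟩
    have : i = 0 := by simpa using hi
    subst this
    exact h
  · intro h
    exact ⟨⟨0, by simp⟩, h⟩

@[simp] theorem vars_app2 {a b s : S} (f : Sg.Sym [a, b] s) (t : Term Sg a) (u : Term Sg b) :
    (app2 f t u).vars = t.vars ∪ u.vars := by
  ext p
  simp only [app2, vars, Set.mem_iUnion, Set.mem_union]
  constructor
  · rintro ⟨⟨i, hi⟩, h⟩
    match i, hi, h with
    | 0, _, h => exact Or.inl h
    | 1, _, h => exact Or.inr h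
  · rintro (h | h)
    · exact ⟨⟨0, by simp⟩, h⟩
    · exact ⟨⟨1, by simp⟩, h⟩

end Term

/-- A substitution maps each variable to a term of the same sort and has finite domain. -/
structure Subst {S : Type u} (Sg : Signature.{u, v} S) where
  map : ∀ s : S, ℕ → Term Sg s
  finite_dom : {p : S × ℕ | map p.1 p.2 ≠ Term.var p.2}.Finite

/-- The application `tσ` of a substitution to a term. -/
def Term.subst {S : Type u} {Sg : Signature.{u, v} S} (σ : Subst Sg) :
    {s : S} → Term Sg s → Term Sg s
  | s, .var x => σ.map s x
  | _, .app f ts => .app f (fun i => (ts i).subst σ)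

/-- A rewrite rule: two terms of the same sort such that all variables of the right-hand side
occur in the left-hand side. -/
structure Rule {S : Type u} (Sg : Signature.{u, v} S) where
  {sort : S}
  lhs : Term Sg sort
  rhs : Term Sg sort
  vars_subset : rhs.vars ⊆ lhs.vars

/-- A (many-sorted) term rewrite system is a set of rewrite rules. -/
abbrev TRS {S : Type u} (Sg : Signature.{u, v} S) := Set (Rule Sg)

section Rewriting

variable {S : Type u} {Sg : Signature.{u, v} S}

/-- The rewrite relation of `R`, the smallest relation on terms that contains the rules of `R`
and is closed under substitutions and contexts. -/
inductive Step (R : TRS Sg) : {s : S} → Term Sg s → Term Sg s → Prop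
  | rule (ρ : Rule Sg) (hρ : ρ ∈ R) (σ : Subst Sg) : Step R (ρ.lhs.subst σ) (ρ.rhs.subst σ)
  | ctx {dom : List S} {s : S} (f : Sg.Sym dom s)
      (ts : ∀ i : Fin dom.length, Term Sg (dom.get i)) (i : Fin dom.length)
      (t' : Term Sg (dom.get i)) (h : Step R (ts i) t') :
      Step R (.app f ts) (.app f (Function.update ts i t'))

variable (Sg) in
/-- The associativity equations `f(f(x,y),z) ≈ f(x,f(y,z))` and the commutativity equations
`f(x,y) ≈ f(y,x)` for all AC symbols `f`, as rules from left to right. -/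
def acAxioms : TRS Sg :=
  {ρ | ∃ s : S, ∃ f ∈ Sg.AC s,
    ρ = ⟨Term.app2 f (Term.app2 f (.var 0) (.var 1)) (.var 2),
        Term.app2 f (.var 0) (Term.app2 f (.var 1) (.var 2)), by simp⟩ ∨
    ρ = ⟨Term.app2 f (.var 0) (.var 1), Term.app2 f (.var 1) (.var 0),
        by simp [Set.union_comm]⟩}

/-- `s =_AC t`: the reflexive, symmetric and transitive closure of `→_AC`. -/
def ACEq {s : S} : Term Sg s → Term Sg s → Prop :=
  Relation.EqvGen (Step (acAxioms Sg))

/-- AC rewriting: the relation `=_AC · →_R · =_AC`. -/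
def ACStep (R : TRS Sg) {s : S} (t u : Term Sg s) : Prop :=
  ∃ t' u' : Term Sg s, ACEq t t' ∧ Step R t' u' ∧ ACEq u' u

/-- `R` is AC terminating if AC rewriting is well-founded on the terms of every sort. -/
def ACTerminating (R : TRS Sg) : Prop :=
  ∀ s : S, WellFounded (fun u t : Term Sg s => ACStep R t u)

end Rewriting

/-- A many-sorted algebra for a signature, whose carriers are non-empty and equipped with
well-founded orders. -/
structure Algebra {S : Type u} (Sg : Signature.{u, v} S) where
  carrier : S → Type w
  nonempty : ∀ s, Nonempty (carrier s)
  order : ∀ s, PartialOrder (carrier s)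
  wellFounded : ∀ s, WellFounded (order s).lt
  interp : ∀ {dom : List S} {s : S}, Sg.Sym dom s →
    (∀ i : Fin dom.length, carrier (dom.get i)) → carrier s

/-- An assignment maps each variable of sort `s` to an element of the carrier of sort `s`. -/
abbrev Algebra.Assignment {S : Type u} {Sg : Signature.{u, v} S} (A : Algebra.{u, v, w} Sg) :=
  ∀ s : S, ℕ → A.carrier s

/-- The interpretation of a term under an assignment. -/
def Algebra.eval {S : Type u} {Sg : Signature.{u, v} S} (A : Algebra.{u, v, w} Sg)
    (α : A.Assignment) : {s : S} → Term Sg s → A.carrier s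
  | s, .var x => α s x
  | _, .app f ts => A.interp f (fun i => A.eval α (ts i))

/-- A labeling for an algebra: a set of labels `L f` for every function symbol `f`, contained in
the carrier of the result sort of `f`, and a labeling function for every `f` with `L f ≠ ∅`.
AC symbols are not labeled. -/
structure Labeling {S : Type u} {Sg : Signature.{u, v} S} (A : Algebra.{u, v, w} Sg) where
  L : ∀ {dom : List S} {s : S}, Sg.Sym dom s → Set (A.carrier s)
  lab : ∀ {dom : List S} {s : S} (f : Sg.Sym dom s), (L f).Nonempty →
    (∀ i : Fin dom.length, A.carrier (dom.get i)) → L f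
  ac_unlabeled : ∀ (s : S), ∀ f ∈ Sg.AC s, L f = ∅

section SemanticLabeling

variable {S : Type u} {Sg : Signature.{u, v} S} {A : Algebra.{u, v, w} Sg}

/-- The symbols of the labeled signature: the symbols `f` with `L f = ∅`, and the symbols `f_a`
with `a ∈ L f`. -/
inductive LabeledSym (ℓ : Labeling A) (dom : List S) (s : S) : Type (max v w)
  | plain (f : Sg.Sym dom s) (h : ℓ.L f = ∅) : LabeledSym ℓ dom s
  | labeled (f : Sg.Sym dom s) (a : ℓ.L f) : LabeledSym ℓ dom s

/-- The labeled signature, with the same (unlabeled) AC symbols. -/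
abbrev Labeling.sig (ℓ : Labeling A) : Signature.{u, max v w} S where
  Sym := LabeledSym ℓ
  AC s := {g | ∃ (f : Sg.Sym [s, s] s) (hf : f ∈ Sg.AC s), g = .plain f (ℓ.ac_unlabeled s f hf)}

open Classical in
/-- The symbol that replaces `f` when the arguments of `f` have the values `as`. -/
noncomputable def Labeling.labelSym (ℓ : Labeling A) {dom : List S} {s : S} (f : Sg.Sym dom s)
    (as : ∀ i : Fin dom.length, A.carrier (dom.get i)) : ℓ.sig.Sym dom s :=
  if h : (ℓ.L f).Nonempty then .labeled f (ℓ.lab f h as)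
  else .plain f (Set.not_nonempty_iff_eq_empty.mp h)

/-- The labeled term `lab_α(t)`. -/
noncomputable def Labeling.labelTerm (ℓ : Labeling A) (α : A.Assignment) :
    {s : S} → Term Sg s → Term ℓ.sig s
  | _, .var x => .var x
  | _, .app f ts =>
      .app (ℓ.labelSym f (fun i => A.eval α (ts i))) (fun i => ℓ.labelTerm α (ts i))

theorem Labeling.vars_labelTerm (ℓ : Labeling A) (α : A.Assignment) {s : S} (t : Term Sg s) :
    (ℓ.labelTerm α t).vars = t.vars := by
  induction t with
  | var x => simp [Labeling.labelTerm]
  | app f ts ih => simp only [Labeling.labelTerm, Term.vars, ih]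

/-- The labeled rule `lab_α(l) → lab_α(r)`. -/
noncomputable def Labeling.labelRule (ℓ : Labeling A) (α : A.Assignment) (ρ : Rule Sg) :
    Rule ℓ.sig where
  lhs := ℓ.labelTerm α ρ.lhs
  rhs := ℓ.labelTerm α ρ.rhs
  vars_subset := by
    rw [ℓ.vars_labelTerm, ℓ.vars_labelTerm]
    exact ρ.vars_subset

/-- The labeled TRS `R_lab`. -/
def Labeling.labeledTRS (ℓ : Labeling A) (R : TRS Sg) : TRS ℓ.sig :=
  {ρ | ∃ ρ₀ ∈ R, ∃ α : A.Assignment, ρ = ℓ.labelRule α ρ₀}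

/-- The TRS `Dec` of all rules `f_a(x₁,…,xₙ) → f_b(x₁,…,xₙ)` with labels `a > b` of `f` and
pairwise different variables `x₁,…,xₙ`. -/
def Labeling.dec (ℓ : Labeling A) : TRS ℓ.sig :=
  {ρ | ∃ (dom : List S) (s : S) (f : Sg.Sym dom s) (a b : ℓ.L f) (x : Fin dom.length → ℕ),
    (A.order s).lt b.1 a.1 ∧
    Function.Injective (fun i => (dom.get i, x i)) ∧
    ρ = { lhs := .app (LabeledSym.labeled f a : ℓ.sig.Sym dom s) (fun i => .var (x i))
          rhs := .app (LabeledSym.labeled f b : ℓ.sig.Sym dom s) (fun i => .var (x i))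
          vars_subset := subset_rfl }}

end SemanticLabeling

/-- The sorts of the encoding of the Battle of Hercules and Hydra. -/
inductive HSort
  | N
  | O
  | S

/-- The function symbols of the encoding: `h` is a head, `i` an internal node, `par` the
(infix) sibling symbol, `zero` and `suc` build natural numbers, and `A`, `B`, `C`, `D`, `E` are
auxiliary symbols. -/
inductive HSym : List HSort → HSort → Type
  | h : HSym [] .O
  | i : HSym [.O] .O
  | E : HSym [.O] .O
  | par : HSym [.O, .O] .O
  | A : HSym [.N, .O] .S
  | B : HSym [.N, .O] .S
  | zero : HSym [] .N
  | suc : HSym [.N] .N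
  | C : HSym [.N, .O] .O
  | D : HSym [.N, .O] .O

/-- The signature of the encoding; the sibling symbol is the only AC symbol. -/
abbrev hydraSig : Signature HSort where
  Sym := HSym
  AC
    | .O => {HSym.par}
    | .N => ∅
    | .S => ∅

namespace Hydra

abbrev T (s : HSort) := Term hydraSig s

def h : T .O := Term.app0 (Sg := hydraSig) HSym.h
def i (x : T .O) : T .O := Term.app1 (Sg := hydraSig) HSym.i x
def E (x : T .O) : T .O := Term.app1 (Sg := hydraSig) HSym.E x
def par (x y : T .O) : T .O := Term.app2 (Sg := hydraSig) HSym.par x y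
def A (n : T .N) (x : T .O) : T .S := Term.app2 (Sg := hydraSig) HSym.A n x
def B (n : T .N) (x : T .O) : T .S := Term.app2 (Sg := hydraSig) HSym.B n x
def zero : T .N := Term.app0 (Sg := hydraSig) HSym.zero
def suc (n : T .N) : T .N := Term.app1 (Sg := hydraSig) HSym.suc n
def C (n : T .N) (x : T .O) : T .O := Term.app2 (Sg := hydraSig) HSym.C n x
def D (n : T .N) (x : T .O) : T .O := Term.app2 (Sg := hydraSig) HSym.D n x
/-- The variable `n` of sort `N`. -/
def n : T .N := .var 0
/-- The variable `x` of sort `O`. -/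
def x : T .O := .var 0
/-- The variable `y` of sort `O`. -/
def y : T .O := .var 1

@[simp] theorem vars_h : h.vars = ∅ := Term.vars_app0 _
@[simp] theorem vars_zero : zero.vars = ∅ := Term.vars_app0 _
@[simp] theorem vars_i (t : T .O) : (i t).vars = t.vars := Term.vars_app1 _ _
@[simp] theorem vars_E (t : T .O) : (E t).vars = t.vars := Term.vars_app1 _ _
@[simp] theorem vars_suc (t : T .N) : (suc t).vars = t.vars := Term.vars_app1 _ _
@[simp] theorem vars_par (t : T .O) (u : T .O) : (par t u).vars = t.vars ∪ u.vars :=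
  Term.vars_app2 _ _ _
@[simp] theorem vars_A (t : T .N) (u : T .O) : (A t u).vars = t.vars ∪ u.vars :=
  Term.vars_app2 _ _ _
@[simp] theorem vars_B (t : T .N) (u : T .O) : (B t u).vars = t.vars ∪ u.vars :=
  Term.vars_app2 _ _ _
@[simp] theorem vars_C (t : T .N) (u : T .O) : (C t u).vars = t.vars ∪ u.vars :=
  Term.vars_app2 _ _ _
@[simp] theorem vars_D (t : T .N) (u : T .O) : (D t u).vars = t.vars ∪ u.vars :=
  Term.vars_app2 _ _ _
@[simp] theorem vars_n : n.vars = {(.N, 0)} := Term.vars_var _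
@[simp] theorem vars_x : x.vars = {(.O, 0)} := Term.vars_var _
@[simp] theorem vars_y : y.vars = {(.O, 1)} := Term.vars_var _

/-- The TRS `𝓗`. -/
def trs : TRS hydraSig :=
  { ⟨A n (i h), A (suc n) h, by simp⟩,
    ⟨A n (i (par h x)), A (suc n) (i x), by simp⟩,
    ⟨A n (i x), B n (D (suc n) (i x)), by simp⟩,
    ⟨C zero x, E x, by simp⟩,
    ⟨C (suc n) x, par x (C n x), by simp [Set.pair_comm]⟩,
    ⟨i (par (E x) y), E (i (par x y)), by simp⟩,
    ⟨i (E x), E (i x), by simp⟩,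
    ⟨D n (i (i x)), i (D n (i x)), by simp⟩,
    ⟨D n (i (par (i x) y)), i (par (D n (i x)) y), by simp⟩,
    ⟨D n (i (par (i (par h x)) y)), i (par (C n (i x)) y), by simp⟩,
    ⟨D n (i (i (par h x))), i (C n (i x)), by simp⟩,
    ⟨D n (i (par (i h) y)), i (par (C n h) y), by simp⟩,
    ⟨D n (i (i h)), i (C n h), by simp⟩,
    ⟨B n (E x), A (suc n) x, by simp⟩ }

end Hydra

/-- Natural (Hessenberg) addition of ordinals: coefficients of equal powers of `ω` in the Cantor
normal forms are added. -/
noncomputable def natAdd (a b : Ordinal.{w}) : Ordinal.{w} :=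
  Ordinal.CNF.eval ω (Ordinal.CNF.coeff ω a + Ordinal.CNF.coeff ω b)

/-- The ordinals smaller than `ε₀`. -/
abbrev OrdE0 : Type 1 := {o : Ordinal.{0} // o < ε₀}

theorem isPrincipal_add_epsilon_zero : Ordinal.IsPrincipal (· + ·) (ε₀ : Ordinal.{0}) := by
  have h := Ordinal.isPrincipal_add_omega0_opow (ε₀ : Ordinal.{0})
  rwa [Ordinal.omega0_opow_epsilon] at h

theorem one_lt_epsilon_zero : (1 : Ordinal.{0}) < ε₀ := by
  exact_mod_cast Ordinal.natCast_lt_epsilon 1 0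

theorem opow_lt_epsilon_zero {a : Ordinal.{0}} (ha : a < ε₀) : ω ^ a < ε₀ := by
  rw [← Ordinal.omega0_opow_epsilon 0]
  exact (Ordinal.opow_lt_opow_iff_right Ordinal.one_lt_omega0).mpr ha

theorem coeff_omega0_lt (a e : Ordinal.{0}) : Ordinal.CNF.coeff ω a e < ω := by
  by_cases h : e ∈ (Ordinal.CNF ω a).map Prod.fst
  · obtain ⟨⟨e', c⟩, hc, rfl⟩ := List.mem_map.1 h
    rw [Ordinal.CNF.coeff_of_mem_CNF hc]
    exact Ordinal.CNF.snd_lt Ordinal.one_lt_omega0 hc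
  · rw [Ordinal.CNF.coeff_of_notMem_CNF h]
    exact Ordinal.omega0_pos

theorem natAdd_lt_epsilon_zero {a b : Ordinal.{0}} (ha : a < ε₀) (hb : b < ε₀) :
    natAdd a b < ε₀ := by
  have hm : max a b + 1 < (ε₀ : Ordinal.{0}) :=
    isPrincipal_add_epsilon_zero (max_lt ha hb) one_lt_epsilon_zero
  have key : ∀ c e : Ordinal.{0}, e ∈ (Ordinal.CNF.coeff ω c).support → e ≤ c := by
    intro c e he
    by_contra hlt
    have : c < ω ^ e := (not_le.1 hlt).trans_le (Ordinal.right_le_opow e Ordinal.one_lt_omega0)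
    exact Finsupp.mem_support_iff.1 he (Ordinal.CNF.coeff_eq_zero_of_lt this)
  refine lt_trans (Ordinal.CNF.eval_lt (e := max a b + 1) ?_ ?_) (opow_lt_epsilon_zero hm)
  · intro e
    rw [Finsupp.add_apply]
    exact Ordinal.isPrincipal_add_omega0 (coeff_omega0_lt a e) (coeff_omega0_lt b e)
  · intro e he
    rcases Finset.mem_union.1 (Finsupp.support_add he) with h | h
    · exact Order.lt_add_one_iff.2 ((key a e h).trans (le_max_left a b))
    · exact Order.lt_add_one_iff.2 ((key b e h).trans (le_max_right a b))

namespace Hydra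

/-- The carriers: `ℕ` for sort `N` and the ordinals below `ε₀` for sorts `O` and `S`. -/
abbrev Carrier : HSort → Type 1
  | .N => ULift.{1} ℕ
  | .O => OrdE0
  | .S => OrdE0

noncomputable def one : OrdE0 := ⟨1, one_lt_epsilon_zero⟩

/-- `ω ^ x` -/
noncomputable def omegaPow (x : OrdE0) : OrdE0 := ⟨ω ^ x.1, opow_lt_epsilon_zero x.2⟩

/-- `x ⊕ y` -/
noncomputable def oplus (x y : OrdE0) : OrdE0 := ⟨natAdd x.1 y.1, natAdd_lt_epsilon_zero x.2 y.2⟩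

/-- `x + 1` -/
noncomputable def plusOne (x : OrdE0) : OrdE0 :=
  ⟨x.1 + 1, isPrincipal_add_epsilon_zero x.2 one_lt_epsilon_zero⟩

/-- `x · n` -/
noncomputable def mulNat (x : OrdE0) (n : ℕ) : OrdE0 :=
  ⟨x.1 * n, isPrincipal_add_epsilon_zero.mul_natCast_lt x.2 n⟩

/-- The interpretation functions. -/
noncomputable def interp : {dom : List HSort} → {s : HSort} → HSym dom s →
    (∀ i : Fin dom.length, Carrier (dom.get i)) → Carrier s
  | _, _, .h, _ => one
  | _, _, .i, as => omegaPow (as ⟨0, by simp⟩)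
  | _, _, .E, as => plusOne (as ⟨0, by simp⟩)
  | _, _, .par, as => oplus (as ⟨0, by simp⟩) (as ⟨1, by simp⟩)
  | _, _, .A, as => as ⟨1, by simp⟩
  | _, _, .B, as => as ⟨1, by simp⟩
  | _, _, .zero, _ => ULift.up 1
  | _, _, .suc, as => ULift.up (ULift.down (as ⟨0, by simp⟩) + 1)
  | _, _, .C, as => plusOne (mulNat (as ⟨1, by simp⟩) (ULift.down (as ⟨0, by simp⟩)))
  | _, _, .D, as => as ⟨1, by simp⟩

/-- The ordinal algebra, with the usual orders on the carriers. -/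
noncomputable abbrev algebra : Algebra.{0, 0, 1} hydraSig where
  carrier := Carrier
  nonempty
    | .N => ⟨ULift.up 0⟩
    | .O => ⟨one⟩
    | .S => ⟨one⟩
  order
    | .N => inferInstanceAs (PartialOrder (ULift.{1} ℕ))
    | .O => inferInstanceAs (PartialOrder OrdE0)
    | .S => inferInstanceAs (PartialOrder OrdE0)
  wellFounded
    | .N => wellFounded_lt (α := ULift.{1} ℕ)
    | .O => wellFounded_lt (α := OrdE0)
    | .S => wellFounded_lt (α := OrdE0)
  interp := interp

/-- The sets of labels: all ordinals below `ε₀` for `A` and `B`; all other symbols are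
unlabeled. -/
def labels : {dom : List HSort} → {s : HSort} → HSym dom s → Set (Carrier s)
  | _, _, .A => Set.univ
  | _, _, .B => Set.univ
  | _, _, _ => ∅

/-- `A` and `B` are labeled by the value of their second argument. -/
noncomputable abbrev labeling : Labeling algebra where
  L := labels
  lab f hf as := match f, hf, as with
    | .A, _, as => ⟨as ⟨1, by simp⟩, trivial⟩
    | .B, _, as => ⟨as ⟨1, by simp⟩, trivial⟩
    | .h, hf, _ => (Set.not_nonempty_empty hf).elim
    | .i, hf, _ => (Set.not_nonempty_empty hf).elim
    | .E, hf, _ => (Set.not_nonempty_empty hf).elim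
    | .par, hf, _ => (Set.not_nonempty_empty hf).elim
    | .zero, hf, _ => (Set.not_nonempty_empty hf).elim
    | .suc, hf, _ => (Set.not_nonempty_empty hf).elim
    | .C, hf, _ => (Set.not_nonempty_empty hf).elim
    | .D, hf, _ => (Set.not_nonempty_empty hf).elim
  ac_unlabeled s f hf := by
    cases s with
    | O => cases hf; rfl
    | N => exact hf.elim
    | S => exact hf.elim

end Hydra

end HydraAC

/-!
The sort `S` occurs in no argument position. A term of sort `S` is therefore a variable or
`A_v(n, t)` or `B_v(n, t)` with `n` and `t` free of `A` and `B`, and rewriting such a term either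
happens at the root or inside a term of sort `O`. (There are no rules of sort `N`.)

* A root step strictly decreases the root symbol in the order `A_v > B_v > A_w > B_w` for `v > w`.
  This is where the ordinal algebra is used: `ω ^ 1 > 1`, `ω ^ (1 ⊕ x) > ω ^ x` and `x + 1 > x`.
* A step inside a term of sort `O` strictly decreases a polynomial interpretation in `ℕ` which
  interprets `∣` by addition and hence is invariant under `=_AC` (`natEval_lt_of_rule`).

The lexicographic combination of the two, `measure`, is invariant under `=_AC` and strictly
decreases in every rewrite step (`measure_eq_of_acEq`, `measure_lt_of_step`).
-/

namespace HydraAC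

/-! ### Evaluation of terms -/

section Evaluation

variable {S : Type u} {Sg : Signature.{u, v} S}

theorem Algebra.eval_subst (M : Algebra.{u, v, w} Sg) (β : M.Assignment) (σ : Subst Sg) {s : S}
    (t : Term Sg s) :
    M.eval β (t.subst σ) = M.eval (fun s x => M.eval β (σ.map s x)) t := by
  induction t with
  | var x => rfl
  | app f ts ih => simp only [Term.subst, Algebra.eval, ih]

end Evaluation

/-! ### Natural addition of one -/

theorem natAdd_one_left (a : Ordinal.{0}) : natAdd 1 a = a + 1 := by
  have h1 : Ordinal.CNF.coeff ω (1 : Ordinal.{0}) = Finsupp.single 0 1 := by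
    rw [← Ordinal.CNF.coeff_eval Ordinal.one_lt_omega0 (f := Finsupp.single 0 1)]
    · simp
    · intro e
      rw [Finsupp.single_apply]
      split_ifs
      exacts [Ordinal.one_lt_omega0, Ordinal.omega0_pos]
  -- Addition of ordinals commutes here because the coefficients are finite.
  have hcomm : Finsupp.single 0 1 + Ordinal.CNF.coeff ω a
      = Ordinal.CNF.coeff ω a + Finsupp.single 0 1 := by
    ext e
    rw [Finsupp.add_apply, Finsupp.add_apply, Finsupp.single_apply]
    split_ifs
    · obtain ⟨k, hk⟩ := Ordinal.lt_omega0.1 (coeff_omega0_lt a e)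
      rw [hk]
      exact_mod_cast Nat.add_comm 1 k
    · simp
  rw [natAdd, h1, hcomm, Ordinal.CNF.eval_add]
  · simp
  · intro e₁ _ e₂ h₂
    have : e₂ = 0 := by
      by_contra hne
      exact Finsupp.mem_support_iff.1 h₂ (Finsupp.single_eq_of_ne hne)
    simp [this]

namespace Hydra

/-! ### The polynomial interpretation -/

/-- The polynomial interpretation in `ℕ` that orients the rules of sort `O`. The values for `A`
and `B` only have to be strictly monotone. `D` is quadratic in its second argument because moving
it below `i`, whose value has slope `2`, has to decrease the value. -/
def poly : {dom : List HSort} → {s : HSort} → HSym dom s → (Fin dom.length → ℕ) → ℕ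
  | _, _, .h, _ => 0
  | _, _, .i, as => 2 * as ⟨0, by simp⟩ + 1
  | _, _, .E, as => as ⟨0, by simp⟩ + 1
  | _, _, .par, as => as ⟨0, by simp⟩ + as ⟨1, by simp⟩
  | _, _, .A, as => as ⟨0, by simp⟩ + as ⟨1, by simp⟩
  | _, _, .B, as => as ⟨0, by simp⟩ + as ⟨1, by simp⟩
  | _, _, .zero, _ => 0
  | _, _, .suc, as => as ⟨0, by simp⟩ + 1
  | _, _, .C, as => (as ⟨0, by simp⟩ + 1) * (as ⟨1, by simp⟩ + 2)
  | _, _, .D, as => (as ⟨0, by simp⟩ + 1) * (as ⟨1, by simp⟩ + 1) ^ 2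

theorem poly_update_lt {dom : List HSort} {s : HSort} (f : HSym dom s) (as : Fin dom.length → ℕ)
    (j : Fin dom.length) (m : ℕ) (h : m < as j) : poly f (Function.update as j m) < poly f as := by
  cases f
  case h => exact j.elim0
  case zero => exact j.elim0
  all_goals
    simp only [List.length_cons, List.length_nil] at j as h
    fin_cases j <;> simp [poly] at h ⊢ <;> first | omega | gcongr

/-- The algebra over `ℕ` given by `poly`. -/
abbrev natAlgebra : Algebra.{0, 0, 0} hydraSig where
  carrier _ := ℕ
  nonempty _ := ⟨0⟩
  order _ := inferInstance
  wellFounded _ := wellFounded_lt (α := ℕ)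
  interp := poly

/-- The algebra `natAlgebra` over the labeled signature: labels are ignored. -/
abbrev labeledNatAlgebra : Algebra.{0, 1, 0} labeling.sig where
  carrier _ := ℕ
  nonempty _ := ⟨0⟩
  order _ := inferInstance
  wellFounded _ := wellFounded_lt (α := ℕ)
  interp
    | .plain f _ => poly f
    | .labeled f _ => poly f

theorem labeledNatAlgebra_interp_update_lt {dom : List HSort} {s : HSort}
    (g : labeling.sig.Sym dom s) (as : Fin dom.length → ℕ) (j : Fin dom.length) (m : ℕ)
    (h : m < as j) :
    labeledNatAlgebra.interp g (Function.update as j m) < labeledNatAlgebra.interp g as := by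
  cases g with
  | plain f _ => exact poly_update_lt f as j m h
  | labeled f _ => exact poly_update_lt f as j m h

theorem labeledNatAlgebra_interp_labelSym {dom : List HSort} {s : HSort} (f : HSym dom s)
    (as : ∀ i : Fin dom.length, Carrier (dom.get i)) :
    labeledNatAlgebra.interp (labeling.labelSym f as) = poly f := by
  unfold Labeling.labelSym
  split_ifs <;> rfl

theorem labeledNatAlgebra_eval_labelTerm (α : algebra.Assignment)
    (β : labeledNatAlgebra.Assignment) {s : HSort} (t : Term hydraSig s) :
    labeledNatAlgebra.eval β (labeling.labelTerm α t) = natAlgebra.eval β t := by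
  induction t with
  | var x => rfl
  | app f ts ih =>
    simp only [Labeling.labelTerm, Algebra.eval, ih]
    exact congrFun (labeledNatAlgebra_interp_labelSym f _) _

/-! ### The measure -/

/-- The rank of the symbol `f` with label `v`: `(v, 1)` for `A_v` and `(v, 0)` for `B_v`. The other
symbols carry no label and share the rank `(0, 0)`. -/
noncomputable def labelRank : {dom : List HSort} → {s : HSort} → HSym dom s → Carrier s →
    Ordinal.{0} ×ₗ ℕ
  | _, _, .A, v => toLex (v.1, 1)
  | _, _, .B, v => toLex (v.1, 0)
  | _, _, _, _ => toLex (0, 0)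

/-- The rank of a symbol of the labeled signature. -/
noncomputable def symRank {dom : List HSort} {s : HSort} :
    labeling.sig.Sym dom s → Ordinal.{0} ×ₗ ℕ
  | .plain _ _ => toLex (0, 0)
  | .labeled f a => labelRank f a.1

/-- The rank of the root symbol; variables are ranked like unlabeled symbols. -/
noncomputable def rootRank {s : HSort} : Term labeling.sig s → Ordinal.{0} ×ₗ ℕ
  | .var _ => toLex (0, 0)
  | .app g _ => symRank g

/-- The value of a labeled term under the polynomial interpretation, with all variables set
to `0`. -/
noncomputable def weight {s : HSort} (t : Term labeling.sig s) : ℕ :=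
  labeledNatAlgebra.eval (fun _ _ => 0) t

/-- The rank of the root symbol, lexicographically followed by the weight. -/
noncomputable def measure {s : HSort} (t : Term labeling.sig s) : (Ordinal.{0} ×ₗ ℕ) ×ₗ ℕ :=
  toLex (rootRank t, weight t)

theorem rootRank_of_sort_ne {s : HSort} (hs : s ≠ .S) (t : Term labeling.sig s) :
    rootRank t = toLex (0, 0) := by
  cases t with
  | var x => rfl
  | app g ts =>
    cases g with
    | plain f _ => rfl
    | labeled f a => cases f <;> first | rfl | exact (hs rfl).elim

/-- The sort `S` is not an argument sort of any symbol. -/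
theorem get_dom_ne_S {dom : List HSort} {s : HSort} (f : HSym dom s) (j : Fin dom.length) :
    dom.get j ≠ .S := by
  cases f <;> fin_cases j <;> simp

theorem get_dom_ne_S_of_labeled {dom : List HSort} {s : HSort} (g : labeling.sig.Sym dom s)
    (j : Fin dom.length) : dom.get j ≠ .S := by
  cases g with
  | plain f _ => exact get_dom_ne_S f j
  | labeled f _ => exact get_dom_ne_S f j

theorem weight_app {dom : List HSort} {s : HSort} (g : labeling.sig.Sym dom s)
    (ts : ∀ i : Fin dom.length, Term labeling.sig (dom.get i)) :
    weight (.app g ts) = labeledNatAlgebra.interp g (fun i => weight (ts i)) := rfl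

theorem weight_update {dom : List HSort}
    (ts : ∀ i : Fin dom.length, Term labeling.sig (dom.get i)) (j : Fin dom.length)
    (t' : Term labeling.sig (dom.get j)) :
    (fun i => weight (Function.update ts j t' i))
      = Function.update (fun i => weight (ts i)) j (weight t') := by
  funext i
  exact Function.apply_update (fun _ t => weight t) ts j t' i

/-- A step below the root leaves the root symbol unchanged and takes place in a term of a sort other
than `S`, where the rank is constant, so that it is the weight that decreases. -/
theorem measure_update_lt {dom : List HSort} {s : HSort} (g : labeling.sig.Sym dom s)
    (ts : ∀ i : Fin dom.length, Term labeling.sig (dom.get i)) (j : Fin dom.length)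
    (t' : Term labeling.sig (dom.get j)) (h : measure t' < measure (ts j)) :
    measure (.app g (Function.update ts j t')) < measure (.app g ts) := by
  have hw : weight t' < weight (ts j) := by
    have hs := get_dom_ne_S_of_labeled g j
    simpa [measure, Prod.Lex.toLex_lt_toLex, rootRank_of_sort_ne hs] using h
  refine Prod.Lex.toLex_lt_toLex.2 (Or.inr ⟨rfl, ?_⟩)
  change weight _ < weight _
  rw [weight_app, weight_app, weight_update]
  exact labeledNatAlgebra_interp_update_lt g _ j _ hw

theorem measure_subst_labelTerm {s : HSort} (hs : s ≠ .S) (α : algebra.Assignment)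
    (σ : Subst labeling.sig) (t : Term hydraSig s) :
    measure ((labeling.labelTerm α t).subst σ)
      = toLex (toLex (0, 0), natAlgebra.eval (fun s x => weight (σ.map s x)) t) := by
  rw [measure, rootRank_of_sort_ne hs, weight, Algebra.eval_subst,
    labeledNatAlgebra_eval_labelTerm]
  rfl

theorem rootRank_subst_labelTerm_A (α : algebra.Assignment) (σ : Subst labeling.sig)
    (t : T .N) (u : T .O) :
    rootRank ((labeling.labelTerm α (A t u)).subst σ) = toLex ((algebra.eval α u).1, 1) := by
  have h : (labeling.L HSym.A).Nonempty := ⟨one, trivial⟩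
  simp only [A, Term.app2, Labeling.labelTerm, Term.subst, rootRank, Labeling.labelSym, dif_pos h]
  rfl

theorem rootRank_subst_labelTerm_B (α : algebra.Assignment) (σ : Subst labeling.sig)
    (t : T .N) (u : T .O) :
    rootRank ((labeling.labelTerm α (B t u)).subst σ) = toLex ((algebra.eval α u).1, 0) := by
  have h : (labeling.L HSym.B).Nonempty := ⟨one, trivial⟩
  simp only [B, Term.app2, Labeling.labelTerm, Term.subst, rootRank, Labeling.labelSym, dif_pos h]
  rfl

/-! ### The measure decreases -/

theorem measure_lt_of_rootRank_lt {s : HSort} {t u : Term labeling.sig s}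
    (h : rootRank u < rootRank t) : measure u < measure t :=
  Prod.Lex.toLex_lt_toLex.2 (Or.inl h)

section

variable (β : natAlgebra.Assignment)

theorem natEval_h : (natAlgebra.eval β h : ℕ) = 0 := rfl

theorem natEval_zero : (natAlgebra.eval β zero : ℕ) = 0 := rfl

theorem natEval_i (t : T .O) :
    (natAlgebra.eval β (i t) : ℕ) = 2 * natAlgebra.eval β t + 1 := rfl

theorem natEval_E (t : T .O) :
    (natAlgebra.eval β (E t) : ℕ) = natAlgebra.eval β t + 1 := rfl

theorem natEval_suc (t : T .N) :
    (natAlgebra.eval β (suc t) : ℕ) = natAlgebra.eval β t + 1 := rfl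

theorem natEval_par (t u : T .O) :
    (natAlgebra.eval β (par t u) : ℕ) = natAlgebra.eval β t + natAlgebra.eval β u := rfl

theorem natEval_C (t : T .N) (u : T .O) :
    (natAlgebra.eval β (C t u) : ℕ) = (natAlgebra.eval β t + 1) * (natAlgebra.eval β u + 2) := rfl

theorem natEval_D (t : T .N) (u : T .O) :
    (natAlgebra.eval β (D t u) : ℕ) =
      (natAlgebra.eval β t + 1) * (natAlgebra.eval β u + 1) ^ 2 := rfl

end

theorem natEval_lt_of_rule {ρ : Rule hydraSig} (hρ : ρ ∈ trs) (hs : ρ.sort ≠ .S)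
    (β : natAlgebra.Assignment) :
    (natAlgebra.eval β ρ.rhs : ℕ) < natAlgebra.eval β ρ.lhs := by
  rcases hρ with rfl | rfl | rfl | rfl | rfl | rfl | rfl | rfl | rfl | rfl | rfl | rfl | rfl | rfl
  all_goals first | exact (hs rfl).elim | skip
  all_goals
    simp only [natEval_h, natEval_zero, natEval_i, natEval_E, natEval_suc, natEval_par, natEval_C,
      natEval_D]
    generalize (natAlgebra.eval β x : ℕ) = a
    generalize (natAlgebra.eval β y : ℕ) = b
    generalize (natAlgebra.eval β n : ℕ) = k
  all_goals nlinarith [Nat.zero_le (k * a), Nat.zero_le (k * b),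
    Nat.zero_le (k * a * b), Nat.zero_le (a * b), Nat.zero_le (k * (a * a)),
    Nat.zero_le (k * (b * b)), Nat.zero_le (a * a), Nat.zero_le (b * b)]

theorem measure_lt_of_labelRule {ρ : Rule hydraSig} (hρ : ρ ∈ trs) (α : algebra.Assignment)
    (σ : Subst labeling.sig) :
    measure ((labeling.labelRule α ρ).rhs.subst σ)
      < measure ((labeling.labelRule α ρ).lhs.subst σ) := by
  by_cases hs : ρ.sort = .S
  · apply measure_lt_of_rootRank_lt
    rcases hρ with rfl | rfl | rfl | rfl | rfl | rfl | rfl | rfl | rfl | rfl | rfl | rfl | rfl | rfl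
    all_goals first | (cases hs; done) | skip
    -- Four rules of sort `S` remain: three for `A` and one for `B`.
    all_goals
      simp only [Labeling.labelRule, rootRank_subst_labelTerm_A, rootRank_subst_labelTerm_B,
        Prod.Lex.toLex_lt_toLex]
    · left
      change (1 : Ordinal) < ω ^ (1 : Ordinal)
      rw [Ordinal.opow_one]
      exact Ordinal.one_lt_omega0
    · left
      change ω ^ (α .O 0).1 < ω ^ natAdd 1 (α .O 0).1
      rw [natAdd_one_left, Ordinal.opow_lt_opow_iff_right Ordinal.one_lt_omega0]
      exact lt_add_one _
    -- `D` is interpreted as a projection, so `A` is replaced by `B` with the same label.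
    · exact Or.inr ⟨rfl, Nat.zero_lt_one⟩
    · left
      change (α .O 0).1 < (α .O 0).1 + 1
      exact lt_add_one _
  · change measure ((labeling.labelTerm α ρ.rhs).subst σ)
      < measure ((labeling.labelTerm α ρ.lhs).subst σ)
    rw [measure_subst_labelTerm hs, measure_subst_labelTerm hs]
    exact Prod.Lex.toLex_lt_toLex.2 (Or.inr ⟨rfl, natEval_lt_of_rule hρ hs _⟩)

theorem measure_lt_of_dec {ρ : Rule labeling.sig} (hρ : ρ ∈ labeling.dec)
    (σ : Subst labeling.sig) : measure (ρ.rhs.subst σ) < measure (ρ.lhs.subst σ) := by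
  obtain ⟨dom, s, f, a, b, x, hab, -, rfl⟩ := hρ
  apply measure_lt_of_rootRank_lt
  cases f
  case A => exact Prod.Lex.toLex_lt_toLex.2 (Or.inl hab)
  case B => exact Prod.Lex.toLex_lt_toLex.2 (Or.inl hab)
  all_goals exact a.2.elim

theorem measure_lt_of_step {s : HSort} {t u : Term labeling.sig s}
    (h : Step (labeling.labeledTRS trs ∪ labeling.dec) t u) : measure u < measure t := by
  induction h with
  | rule ρ hρ σ =>
    rcases hρ with ⟨ρ₀, hρ₀, α, rfl⟩ | hρ
    · exact measure_lt_of_labelRule hρ₀ α σ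
    · exact measure_lt_of_dec hρ σ
  | ctx g ts j t' _ ih => exact measure_update_lt g ts j t' ih

/-! ### Invariance under AC equivalence -/

theorem measure_eq_of_acAxioms {ρ : Rule labeling.sig} (hρ : ρ ∈ acAxioms labeling.sig)
    (σ : Subst labeling.sig) : measure (ρ.lhs.subst σ) = measure (ρ.rhs.subst σ) := by
  obtain ⟨s, g, ⟨f, hf, rfl⟩, hρ⟩ := hρ
  cases s with
  | N => exact hf.elim
  | S => exact hf.elim
  | O =>
    cases hf
    -- Both sides have the same root, so only the weights have to be compared.
    rcases hρ with rfl | rfl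
    · exact Prod.ext rfl (Nat.add_assoc _ _ _)
    · exact Prod.ext rfl (Nat.add_comm _ _)

theorem measure_eq_of_acStep {s : HSort} {t u : Term labeling.sig s}
    (h : Step (acAxioms labeling.sig) t u) : measure t = measure u := by
  induction h with
  | rule ρ hρ σ => exact measure_eq_of_acAxioms hρ σ
  | ctx g ts j t' _ ih =>
    have hw : weight (ts j) = weight t' := congrArg (fun p => (ofLex p).2) ih
    rw [measure, measure, weight_app, weight_app, weight_update, ← hw, Function.update_eq_self]
    rfl

theorem measure_eq_of_acEq {s : HSort} {t u : Term labeling.sig s} (h : ACEq t u) :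
    measure t = measure u := by
  induction h with
  | rel _ _ h => exact measure_eq_of_acStep h
  | refl _ => rfl
  | symm _ _ _ ih => exact ih.symm
  | trans _ _ _ _ _ ih₁ ih₂ => exact ih₁.trans ih₂

end Hydra

end HydraAC

theorem mainTheorem7 :
    HydraAC.ACTerminating
      (HydraAC.Hydra.labeling.labeledTRS HydraAC.Hydra.trs ∪ HydraAC.Hydra.labeling.dec) := by
  intro s
  refine Subrelation.wf ?_ (InvImage.wf HydraAC.Hydra.measure wellFounded_lt)
  rintro u t ⟨t', u', ht, h, hu⟩
  change HydraAC.Hydra.measure u < HydraAC.Hydra.measure t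
  rw [HydraAC.Hydra.measure_eq_of_acEq ht, ← HydraAC.Hydra.measure_eq_of_acEq hu]
  exact HydraAC.Hydra.measure_lt_of_step h
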